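/- Let $\lambda>\aleph_1$ be a regular cardinal. A ray in a graph is a one-way infinite path; two rays are tail-equivalent if they share a common tail (final segment). Let $\mathcal G$ be the class of graphs $G$ such that for every vertex $v$ the subgraph of $G$ induced on the neighbourhood of $v$ has at most one ray up to tail-equivalence, and let $\mathcal G_\lambda$ be the collection of isomorphism types of graphs in $\mathcal G$ with exactly $\lambda$ vertices, quasi-ordered by $G\le_w H$ iff $G$ is isomorphic to a (not necessarily induced) subgraph of $H$. For a set $A$ let $[A]^{\le\lambda}$ be the set of subsets of $A$ of cardinality at most $\lambda$, ordered by inclusion; for an ideal $I$ over $\lambda$ let $([A]^{\le\lambda},\subseteq)^\lambda/I$ be the reduced power: classes of sequences $\langle A_\delta:\delta<\lambda\rangle$ modulo $I$, with $[\langle A_\delta\rangle]\le[\langle B_\delta\rangle]$ iff $\{\delta: A_\delta\not\subseteq B_\delta\}\in I$. A homomorphism is an order-preserving map. Let $\mathcal P(\omega)/\mathrm{fin}$ be the set of subsets of $\omega$ modulo finite symmetric difference. A club guessing sequence is a sequence $\bar C=\langle c_\delta:\delta\in S\rangle$, with $S\subseteq\lambda$ stationary, such that each $c_\delta\subseteq\delta$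 has order type $\omega$ and $\sup c_\delta=\delta$, and such that for every club $E\subseteq\lambda$ the set $\{\delta\in S:c_\delta\subseteq E\}$ is stationary. Let $\mathrm{id}^b(\bar C)$ be the set of those $X\subseteq\lambda$ for which there is a club $E\subseteq\lambda$ such that for no $\delta\in S\cap E\cap X$ is an end segment of $c_\delta$ contained in $E$. Then there are a club guessing sequence $\bar C$ such that $I=\mathrm{id}^b(\bar C)$ is a normal ideal over $\lambda$ (proper, containing all bounded sets, $\lambda$-complete, closed under diagonal unions), and a surjective homomorphism $$\Phi:\langle\mathcal G_\lambda,\le_w\rangle\to([\mathbb R]^{\le\lambda},\subseteq),$$ with the following properties. (a) $\Phi=\psi\circ\varphi$ for a surjective homomorphism $\varphi:\langle\mathcal G_\lambda,\le_w\rangle\to([\mathbb R]^{\le\lambda},\subseteq)^\lambda/I$ and the surjective homomorphism $\psi:([\mathbb R]^{\le\lambda},\subseteq)^\lambda/I\to([\mathbb R]^{\le\lambda},\subseteq)$ given by $\psi([\langle A_\delta\rangle])=\{x:\{\delta<\lambda:x\in A_\delta\}\notin I\}$. (b) The same holds with $\mathcal P(\omega)/\mathrm{fin}$ in the reduced power: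 for some bijection $e:\mathcal P(\omega)/\mathrm{fin}\to\mathbb R$, $\Phi=\psi'\circ\varphi'$ for a surjective homomorphism $\varphi':\langle\mathcal G_\lambda,\le_w\rangle\to([\mathcal P(\omega)/\mathrm{fin}]^{\le\lambda},\subseteq)^\lambda/I$ and the surjective homomorphism $\psi':([\mathcal P(\omega)/\mathrm{fin}]^{\le\lambda},\subseteq)^\lambda/I\to([\mathbb R]^{\le\lambda},\subseteq)$ given by $\psi'([\langle A_\delta\rangle])=e[\{x:\{\delta<\lambda:x\in A_\delta\}\notin I\}]$. -/

import Mathlib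

open Cardinal

universe u v

namespace RayGraphs

/-! ### Rays and the class of graphs -/

/-- A ray in `G`: a one-way infinite path, given by the sequence of its (distinct) vertices. -/
structure Ray {V : Type u} (G : SimpleGraph V) where
  /-- The vertices of the ray, in order. -/
  vert : ℕ → V
  injective : Function.Injective vert
  adj : ∀ n, G.Adj (vert n) (vert (n + 1))

/-- Two rays are tail-equivalent when they share a common tail.  The tails of a ray are its
final segments. -/
def Ray.TailEquiv {V : Type u} {G : SimpleGraph V} (R S : Ray G) : Prop :=
  ∃ m n : ℕ, ∀ k : ℕ, R.vert (m + k) = S.vert (n + k)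

/-- The class of graphs in which, for every vertex `v`, the subgraph induced on the neighbourhood
of `v` has at most one ray up to tail-equivalence. -/
def InClass {V : Type u} (G : SimpleGraph V) : Prop :=
  ∀ v : V, ∀ R S : Ray (G.induce (G.neighborSet v)), R.TailEquiv S

/-- A graph in the class with exactly `κ` vertices. -/
structure ClassGraph (κ : Cardinal.{u}) where
  /-- The vertex set. -/
  V : Type u
  /-- The graph. -/
  graph : SimpleGraph V
  card_eq : #V = κ
  inClass : InClass graph

/-- Isomorphism of graphs in the class. -/
instance classGraphSetoid (κ : Cardinal.{u}) : Setoid (ClassGraph κ) where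
  r G H := Nonempty (G.graph ≃g H.graph)
  iseqv :=
    { refl := fun _ => ⟨SimpleGraph.Iso.refl⟩
      symm := fun ⟨e⟩ => ⟨e.symm⟩
      trans := fun ⟨e⟩ ⟨f⟩ => ⟨f.comp e⟩ }

/-- The isomorphism types of graphs of cardinality `κ` in the class. -/
def IsoTypes (κ : Cardinal.{u}) : Type (u + 1) :=
  Quotient (classGraphSetoid κ)

/-- Weak embeddability of isomorphism types: `G` is isomorphic to a (not necessarily induced)
subgraph of `H`. -/
def WeakEmb {κ : Cardinal.{u}} : IsoTypes κ → IsoTypes κ → Prop :=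
  Quotient.lift₂ (fun G H => SimpleGraph.IsContained G.graph H.graph)
    (fun _ _ _ _ ⟨e⟩ ⟨f⟩ => propext
      ⟨fun ⟨c⟩ => ⟨(f.toCopy.comp c).comp e.symm.toCopy⟩,
       fun ⟨c⟩ => ⟨(f.symm.toCopy.comp c).comp e.toCopy⟩⟩)

/-- Isomorphism types are quasi-ordered by weak embeddability. -/
instance isoTypesPreorder (κ : Cardinal.{u}) : Preorder (IsoTypes κ) where
  le := WeakEmb
  le_refl a := by
    induction a using Quotient.inductionOn with
    | h G => exact SimpleGraph.IsContained.refl G.graph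
  le_trans a b c := by
    induction a using Quotient.inductionOn with
    | h G =>
      induction b using Quotient.inductionOn with
      | h H =>
        induction c using Quotient.inductionOn with
        | h K => exact fun h k => SimpleGraph.IsContained.trans h k

/-! ### Small subsets and the power set of `ω` modulo finite sets -/

/-- The subsets of `A` of cardinality at most `κ`, partially ordered by inclusion. -/
abbrev SmallSubsets (A : Type v) (κ : Cardinal.{u}) : Type v :=
  {s : Set A // Cardinal.lift.{u} #s ≤ Cardinal.lift.{v} κ}

/-- Equality modulo a finite set. -/
instance modFinSetoid : Setoid (Set ℕ) where
  r X Y := (symmDiff X Y).Finite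
  iseqv :=
    { refl := fun X => by simp
      symm := fun {X Y} h => by rwa [symmDiff_comm]
      trans := fun {X Y Z} h k => (h.union k).subset (symmDiff_triangle X Y Z) }

/-- `P(ω)/fin`. -/
def PowModFin : Type :=
  Quotient modFinSetoid

/-! ### Club guessing and ideals over `κ` -/

/-- The set of ordinals below (the initial ordinal of) `κ`. -/
abbrev Below (κ : Cardinal.{u}) : Type (u + 1) :=
  Set.Iio κ.ord

/-- `c` is almost contained in `E`: an end segment of `c` is contained in `E`. -/
def AlmostSubset {κ : Cardinal.{u}} (c E : Set (Below κ)) : Prop :=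
  ∃ β ∈ c, ∀ γ ∈ c, β ≤ γ → γ ∈ E

/-- `⟨C δ : δ ∈ S⟩` is a club guessing sequence on the stationary set `S ⊆ κ`, with every `C δ`
cofinal in `δ` and of order type `ω`.  The values of `C` outside `S` are irrelevant. -/
structure IsClubGuessing {κ : Cardinal.{u}} (S : Set (Below κ)) (C : Below κ → Set (Below κ)) :
    Prop where
  stationary : IsStationary S
  subset : ∀ δ ∈ S, C δ ⊆ Set.Iio δ
  isLUB : ∀ δ ∈ S, IsLUB (C δ) δ
  type_eq : ∀ δ ∈ S, Nonempty (ℕ ≃o C δ)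
  guess : ∀ E : Set (Below κ), IsClub E → IsStationary {δ | δ ∈ S ∧ C δ ⊆ E}

/-- Membership in the guessing ideal `id^b(C)`: for some club `E`, no `δ ∈ S ∩ E ∩ X` has `C δ`
almost contained in `E`. -/
def GuessingNull {κ : Cardinal.{u}} (S : Set (Below κ)) (C : Below κ → Set (Below κ))
    (X : Set (Below κ)) : Prop :=
  ∃ E : Set (Below κ), IsClub E ∧ ∀ δ ∈ S ∩ E ∩ X, ¬ AlmostSubset (C δ) E

/-- A normal ideal over `κ`: proper, containing all bounded sets, `κ`-complete and closed under
diagonal unions. -/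
structure IsNormalIdeal {κ : Cardinal.{u}} (I : Order.Ideal (Set (Below κ))) : Prop where
  proper : Set.univ ∉ I
  bounded : ∀ β : Below κ, Set.Iio β ∈ I
  complete : ∀ F : Set (Set (Below κ)), #F < Cardinal.lift.{u + 1} κ → (∀ X ∈ F, X ∈ I) →
    ⋃₀ F ∈ I
  diagonal : ∀ X : Below κ → Set (Below κ), (∀ α, X α ∈ I) → {δ | ∃ α < δ, δ ∈ X α} ∈ I

/-- The dual filter of an ideal of sets. -/
def dualFilter {κ : Cardinal.{u}} (I : Order.Ideal (Set (Below κ))) : Filter (Below κ) :=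
  Filter.comk (fun X => X ∈ I) I.bot_mem (fun _ ht _ hs => I.lower hs ht)
    (fun _ hs _ ht => I.sup_mem hs ht)

/-- The reduced power `([A]^{≤ κ}, ⊆)^κ / I`, consisting of the classes of sequences modulo `I`
and partially ordered by inclusion on all coordinates outside a set from `I`. -/
abbrev ReducedPower (A : Type v) {κ : Cardinal.{u}} (I : Order.Ideal (Set (Below κ))) :
    Type (max (u + 1) v) :=
  Filter.Germ (dualFilter I) (SmallSubsets A κ)

/-- The elements which belong to `I`-positively many coordinates of a sequence. -/
def positivePart {A : Type v} {κ : Cardinal.{u}} (I : Order.Ideal (Set (Below κ)))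
    (s : Below κ → SmallSubsets A κ) : Set A :=
  {x | {δ | x ∈ (s δ).1} ∉ I}

end RayGraphs

-- Enumerate each guessing set `C δ` increasingly as a ladder and label the vertices of a graph
-- bijectively by the ordinals below `κ`. A ray in the neighbourhood of a vertex leaves a trace: the
-- set of ladder intervals that its labels visit. Finitely many vertices meet finitely many
-- intervals, so modulo finite sets the trace depends only on the tail class, and in the class of
-- graphs each vertex codes at most one element of `PowModFin`. Hence a graph codes at most `κ`
-- elements at each `δ` (`mk_codes_le`).
--
-- A copy of `G` in `H` may change labels, but a club of ordinals is closed under the change in both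
-- directions. If an end segment of `C δ` lies in this club, the cuts at late ladder points are
-- preserved, and so are traces modulo finite sets (`codes_subset_of_copy`). The exceptional `δ`
-- form a set in the guessing ideal, so the class of the code sequence is monotone under weak
-- embedding and independent of the labelling.
--
-- Every sequence is realised (`codeHom_surjective`): to the tree of finite lists of ordinals add,
-- for each `δ ∈ S` and each element to be coded at `δ`, an apex joined to a branch running through
-- a suitable subset of the ladder. Only apices have rays in their neighbourhoods, one up to tails,
-- and branches converging elsewhere leave finite traces at `δ`. Coding by the infinite sets `padOdd
-- X` makes finite traces code nothing. Taking positive parts, and transporting along a bijection of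
-- `PowModFin` with the reals, gives both factorisations. Club guessing itself comes from
-- `exists_gluedLadder_subset`.

universe w

namespace RayGraphs

/-! ### Clubs in well-orders of uncountable cofinality -/

section WellOrder

open Order Set

variable {α : Type v} [LinearOrder α]

theorem exists_forall_lt_of_mk_lt_cof {s : Set α} (hs : #s < cof α) : ∃ b, ∀ x ∈ s, x < b :=
  not_isCofinal_iff.1 fun h => (cof_le h).not_gt hs

theorem isClub_Ioi [NoMaxOrder α] (b : α) : IsClub (Ioi b) where
  dirSupClosed := by
    rintro d hd ⟨y, hy⟩ - x hx
    exact lt_of_lt_of_le (hd hy) (hx.1 hy)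
  isCofinal a := by
    obtain ⟨c, hc⟩ := exists_gt (max a b)
    exact ⟨c, (le_max_right a b).trans_lt hc, ((le_max_left a b).trans_lt hc).le⟩

variable [WellFoundedLT α]

theorem exists_isLUB_of_mk_lt_cof {s : Set α} (hs : #s < cof α) : ∃ x, IsLUB s x := by
  obtain ⟨b, hb⟩ := exists_forall_lt_of_mk_lt_cof hs
  have hne : (upperBounds s).Nonempty := ⟨b, fun x hx => (hb x hx).le⟩
  exact ⟨wellFounded_lt.min _ hne, wellFounded_lt.min_mem _ hne,
    fun y hy => not_lt.1 (wellFounded_lt.not_lt_min _ hy)⟩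

theorem exists_strictMono_isLUB (hω : ℵ₀ < cof α) {P : α → α → Prop}
    (hP : ∀ a, ∃ b, a < b ∧ P a b) (a : α) :
    ∃ (f : ℕ → α) (x : α), StrictMono f ∧ f 0 = a ∧ (∀ n, P (f n) (f (n + 1))) ∧
      IsLUB (range f) x := by
  choose g hg hgP using hP
  let f : ℕ → α := fun n => g^[n] a
  have hf : ∀ n, f (n + 1) = g (f n) := fun n => Function.iterate_succ_apply' g n a
  obtain ⟨x, hx⟩ := exists_isLUB_of_mk_lt_cof (s := range f)
    (((le_aleph0_iff_set_countable).2 (countable_range f)).trans_lt hω)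
  exact ⟨f, x, strictMono_nat_of_lt_succ fun n => (hf n).symm ▸ hg _, rfl,
    fun n => (hf n).symm ▸ hgP _, hx⟩

/-- Diagonal intersections of clubs are clubs. -/
theorem isClub_diagonal [NoMaxOrder α] (hω : ℵ₀ < cof α) (hα : ∀ a : α, #(Iio a) < cof α)
    {E : α → Set α} (hE : ∀ a, IsClub (E a)) : IsClub {x | ∀ a < x, x ∈ E a} where
  dirSupClosed := by
    rintro d hd hne - x hx a ha
    obtain ⟨y, hy, hay⟩ := (lt_isLUB_iff hx).1 ha
    -- The part of `d` from `y` on has the same supremum and lies entirely in `E a`, because `a <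
    -- y`.
    refine (hE a).isLUB_mem (t := d ∩ Ici y) (fun z hz => hd hz.1 a (hay.trans_le hz.2))
      ⟨y, hy, le_rfl⟩ ⟨fun z hz => hx.1 hz.1, fun b hb => hx.2 fun z hz => ?_⟩
    rcases le_total z y with h | h
    · exact h.trans (hb ⟨hy, le_rfl⟩)
    · exact hb ⟨hz, h⟩
  isCofinal a := by
    have hP : ∀ b : α, ∃ c, b < c ∧ ∀ d < b, c ∈ E d := by
      intro b
      have hb : IsClub (⋂ d : Iio b, E d) :=
        IsClub.iInter hω.ne' (by simpa using hα b) fun d => hE d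
      obtain ⟨b', hb'⟩ := exists_gt b
      obtain ⟨c, hc, hc'⟩ := hb.isCofinal b'
      exact ⟨c, hb'.trans_le hc', fun d hd => mem_iInter.1 hc ⟨d, hd⟩⟩
    obtain ⟨f, x, hf, h0, hfP, hx⟩ := exists_strictMono_isLUB hω hP a
    refine ⟨x, fun b hb => ?_, h0 ▸ hx.1 ⟨0, rfl⟩⟩
    obtain ⟨_, ⟨n, rfl⟩, hn⟩ := (lt_isLUB_iff hx).1 hb
    refine (hE b).isLUB_mem (t := range fun k => f (n + k + 1)) ?_ (range_nonempty _)
      ⟨?_, fun c hc => hx.2 ?_⟩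
    · rintro _ ⟨k, rfl⟩
      exact hfP _ b (hn.trans_le (hf.monotone (by omega)))
    · rintro _ ⟨k, rfl⟩
      exact hx.1 ⟨_, rfl⟩
    · rintro _ ⟨k, rfl⟩
      exact (hf.monotone (by omega)).trans (hc ⟨k, rfl⟩)

/-- The points closed under a relation `p v ↦ q v` form a club when `p` has small fibres. -/
theorem isClub_closed [NoMaxOrder α] (hω : ℵ₀ < cof α) (hα : ∀ a : α, #(Iio a) < cof α)
    {V : Type u} {p q : V → α}
    (hp : ∀ a, Cardinal.lift.{v} #{w // p w = a} < Cardinal.lift.{u} (cof α)) :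
    IsClub {x | ∀ w, p w < x → q w < x} := by
  have := isClub_diagonal hω hα (E := fun a => ⋂ w : {w // p w = a}, Ioi (q w))
    fun a => IsClub.iInter hω.ne' (hp a) fun w => isClub_Ioi _
  refine (congrArg IsClub ?_).mp this
  ext x
  simp only [mem_ofPred_eq, mem_iInter, mem_Ioi, Subtype.forall]
  exact ⟨fun h w hw => h _ hw w rfl, fun h a ha w hw => h w (hw ▸ ha)⟩

theorem exists_isGreatest_inter_Iic {E : Set α} (hE : IsClub E) {x : α}
    (hne : (E ∩ Iic x).Nonempty) : ∃ y, IsGreatest (E ∩ Iic x) y := by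
  have hub : (upperBounds (E ∩ Iic x)).Nonempty := ⟨x, fun y hy => hy.2⟩
  have hlub : IsLUB (E ∩ Iic x) (wellFounded_lt.min _ hub) :=
    ⟨wellFounded_lt.min_mem _ hub, fun y hy => not_lt.1 (wellFounded_lt.not_lt_min _ hy)⟩
  exact ⟨_, ⟨hE.isLUB_mem inter_subset_left hne hlub, hlub.2 fun y hy => hy.2⟩, hlub.1⟩

theorem nonempty_orderIso_nat {T : Set α} (hne : T.Nonempty) (hmax : ∀ x ∈ T, ∃ y ∈ T, x < y)
    (hfin : ∀ x ∈ T, (T ∩ Iio x).Finite) : Nonempty (ℕ ≃o T) := by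
  have : Nonempty T := hne.to_subtype
  have : NoMaxOrder T := ⟨fun x => by
    obtain ⟨y, hy, hxy⟩ := hmax x x.2
    exact ⟨⟨y, hy⟩, hxy⟩⟩
  have hIic : ∀ x : T, (Iic x).Finite := fun x => by
    have h : (Iio x).Finite := by
      refine ((hfin x x.2).preimage Subtype.val_injective.injOn).subset fun y hy => ⟨y.2, hy⟩
    rw [← Iio_union_right]
    exact h.union (finite_singleton x)
  let _ : LocallyFiniteOrder T :=
    LocallyFiniteOrder.ofFiniteIcc fun x y => (hIic y).subset fun z hz => hz.2
  let _ : OrderBot T := WellFoundedLT.toOrderBot T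
  let _ : SuccOrder T := LinearLocallyFiniteOrder.succOrder T
  let _ : PredOrder T := LinearLocallyFiniteOrder.predOrder T
  exact ⟨orderIsoNatOfLinearSuccPredArch.symm⟩

end WellOrder

/-! ### Cardinality and cofinality of the ordinals below a regular cardinal -/

section Below

open Order Set

variable {κ : Cardinal.{u}}

theorem lift_aleph_one : Cardinal.lift.{v} (ℵ₁ : Cardinal.{u}) = ℵ₁ := by
  simp

theorem mk_below (κ : Cardinal.{u}) : #(Below κ) = Cardinal.lift.{u + 1} κ := by
  simp [mk_Iio_ordinal]

theorem cof_below (hreg : κ.IsRegular) : cof (Below κ) = Cardinal.lift.{u + 1} κ := by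
  rw [Ordinal.cof_Iio, ← Ordinal.lift_cof, hreg.cof_ord]

theorem noMaxOrder_below (hreg : κ.IsRegular) : NoMaxOrder (Below κ) :=
  ⟨fun x => ⟨⟨Order.succ x.1, (isSuccLimit_ord hreg.aleph0_le).succ_lt x.2⟩, Order.lt_succ x.1⟩⟩

theorem nonempty_below (hreg : κ.IsRegular) : Nonempty (Below κ) :=
  ⟨⟨0, (isSuccLimit_ord hreg.aleph0_le).bot_lt⟩⟩

theorem mk_Iio_lt_cof_below (hreg : κ.IsRegular) (x : Below κ) : #(Iio x) < cof (Below κ) := by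
  rw [cof_below hreg]
  have h : #(Iio x) ≤ #(Iio x.1) :=
    mk_le_of_injective (f := fun y : Iio x => (⟨y.1.1, y.2⟩ : Iio x.1)) fun y z h => by
      simpa [Subtype.ext_iff] using h
  refine h.trans_lt ?_
  rw [mk_Iio_ordinal, Cardinal.lift_lt]
  exact lt_ord.1 x.2

end Below

/-! ### Club guessing in ZFC -/

section ClubGuessing

open Order Set

variable {α : Type v} [LinearOrder α]

/-- The ladder `a` glued to the set `E`. -/
def gluedLadder (E : Set α) (a : ℕ → α) : Set α :=
  {y | ∃ n, IsGreatest (E ∩ Iic (a n)) y}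

variable {E : Set α} {a : ℕ → α} {δ : α}

theorem gluedLadder_subset_Iio (ha : ∀ n, a n < δ) : gluedLadder E a ⊆ Iio δ := by
  rintro y ⟨n, hn⟩
  exact hn.1.2.trans_lt (ha n)

theorem gluedLadder_inter_Iio_finite (hmono : Monotone a) {x : α} (hx : x ∈ gluedLadder E a) :
    (gluedLadder E a ∩ Iio x).Finite := by
  obtain ⟨n, hn⟩ := hx
  have hfin : (⋃ m ∈ Iio n, {y | IsGreatest (E ∩ Iic (a m)) y}).Finite :=
    (finite_Iio n).biUnion fun m _ => Subsingleton.finite fun y hy z hz => hy.unique hz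
  refine hfin.subset ?_
  rintro y ⟨⟨m, hm⟩, hyx⟩
  refine mem_biUnion (x := m) ?_ hm
  by_contra! hnm
  exact (lt_irrefl y) (hyx.trans_le (hm.2 ⟨hn.1.1, hn.1.2.trans (hmono (not_lt.1 hnm))⟩))

variable [WellFoundedLT α]

/-- As the clubs shrink, the largest element not above `x` can only decrease, so by well-foundedness
it stabilises; if it ceases to exist, the claim is vacuous from there on. -/
theorem exists_stable_isGreatest {ι : Type*} [LinearOrder ι] [Nonempty ι] {E : ι → Set α}
    (hE : ∀ i, IsClub (E i)) (hanti : Antitone E) (x : α) :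
    ∃ i, ∀ j k, i ≤ j → i ≤ k → ∀ y, IsGreatest (E j ∩ Iic x) y → IsGreatest (E k ∩ Iic x) y := by
  by_cases h : ∃ i, ¬ (E i ∩ Iic x).Nonempty
  · obtain ⟨i, hi⟩ := h
    exact ⟨i, fun j _ hj _ y hy => (hi ⟨y, hanti hj hy.1.1, hy.1.2⟩).elim⟩
  push Not at h
  choose m hm using fun i => exists_isGreatest_inter_Iic (hE i) (h i)
  have hmono : ∀ {i j}, i ≤ j → m j ≤ m i := fun hij =>
    (hm _).2 ⟨hanti hij (hm _).1.1, (hm _).1.2⟩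
  obtain ⟨i, hi⟩ : ∃ i, ∀ j, ¬ m j < m i := by
    obtain ⟨_, ⟨i, rfl⟩, hi⟩ := wellFounded_lt.has_min (range m) (range_nonempty m)
    exact ⟨i, fun j => hi _ ⟨j, rfl⟩⟩
  have heq : ∀ j, i ≤ j → m j = m i := fun j hj => le_antisymm (hmono hj) (not_lt.1 (hi j))
  refine ⟨i, fun j k hj hk y hy => ?_⟩
  rw [hy.unique (hm j), heq j hj, ← heq k hk]
  exact hm k

/-- If every club `E` failed, with witness `G E`, then `E` could be shrunk `ω₁` times, each stage
entering the witnesses of all earlier ones. At a limit point `δ ∈ S` of the intersection, each of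
the countably many glued points stabilises at a countable stage. A stage beyond all of these has its
glued ladder inside the next club, hence inside its own witness: a contradiction. -/
theorem exists_gluedLadder_subset (hα : ℵ₁ < cof α) {S : Set α} {a : α → ℕ → α}
    (hS : ∀ E, IsClub E → ∃ δ ∈ S, IsLUB (E ∩ Iio δ) δ) :
    ∃ E, IsClub E ∧ ∀ F, IsClub F →
      ∃ δ ∈ S, IsLUB (E ∩ Iio δ) δ ∧ gluedLadder E (a δ) ⊆ F := by
  by_contra! hcon
  choose! G hG hGS using hcon
  have hω : cof α ≠ ℵ₀ := (aleph0_lt_aleph_one.trans hα).ne'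
  have hreg : (ℵ₁ : Cardinal.{0}).IsRegular := isRegular_aleph_one
  let I := Below (ℵ₁ : Cardinal.{0})
  have : Nonempty I := nonempty_below hreg
  have : NoMaxOrder I := noMaxOrder_below hreg
  have hcountable : ∀ i : I, Countable (Iio i) := fun i => by
    rw [← mk_le_aleph0_iff]
    have := mk_Iio_lt_cof_below hreg i
    rw [cof_below hreg, lift_aleph_one] at this
    exact lt_aleph_one_iff.1 this
  let E : I → Set α := (wellFounded_lt (α := I)).fix
    fun i e => ⋂ j : Iio i, e j.1 j.2 ∩ G (e j.1 j.2)
  have hEeq : ∀ i, E i = ⋂ j : Iio i, E j ∩ G (E j) := fun i =>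
    (wellFounded_lt (α := I)).fix_eq _ i
  have hE : ∀ i, IsClub (E i) := by
    intro i
    induction i using WellFoundedLT.induction with
    | ind i ih =>
      rw [hEeq]
      have := hcountable i
      exact IsClub.iInter_of_countable hω fun j =>
        (ih j.1 j.2).inter hω (hG _ (ih j.1 j.2))
  have hlt : ∀ {i j}, i < j → E j ⊆ E i ∩ G (E i) := fun {i j} hij => by
    rw [hEeq j]
    exact iInter_subset (fun k : Iio j => E k ∩ G (E k)) ⟨i, hij⟩
  have hanti : Antitone E := fun i j hij => by
    rcases hij.eq_or_lt with rfl | h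
    · exact le_rfl
    · exact fun x hx => (hlt h hx).1
  have hI : IsClub (⋂ i, E i) := IsClub.iInter hω (by
    rw [mk_below, lift_aleph_one, lift_aleph_one, ← lift_aleph_one.{v, 1}, Cardinal.lift_lt]
    exact hα) hE
  obtain ⟨δ, hδ, hlub⟩ := hS _ hI
  choose i hi using fun n => exists_stable_isGreatest hE hanti (a δ n)
  obtain ⟨s, hs⟩ := exists_forall_lt_of_mk_lt_cof (s := range i) (by
    rw [cof_below hreg, lift_aleph_one]
    exact (le_aleph0_iff_set_countable.2 (countable_range i)).trans_lt aleph0_lt_aleph_one)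
  obtain ⟨t, ht⟩ := exists_gt s
  refine hGS _ (hE s) δ hδ ⟨fun x hx => hx.2.le, fun b hb => hlub.2 fun x hx =>
    hb ⟨mem_iInter.1 hx.1 s, hx.2⟩⟩ ?_
  rintro y ⟨n, hn⟩
  have hns := hs (i n) ⟨n, rfl⟩
  -- The point glued at stage `s` is still the glued point at the later stage `t`, and `E t ⊆ G (E
  -- s)`.
  exact (hlt ht (hi n s t hns.le (hns.trans ht).le y hn).1.1).2

theorem exists_gluedLadder_gt (hE : IsClub E) (hlub : IsLUB (E ∩ Iio δ) δ)
    (ha : IsLUB (range a) δ) {x : α} (hx : x < δ) : ∃ y ∈ gluedLadder E a, x < y := by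
  obtain ⟨e, he, hxe⟩ := (lt_isLUB_iff hlub).1 hx
  obtain ⟨_, ⟨n, rfl⟩, hn⟩ := (lt_isLUB_iff ha).1 he.2
  obtain ⟨y, hy⟩ := exists_isGreatest_inter_Iic hE (x := a n) ⟨e, he.1, hn.le⟩
  exact ⟨y, ⟨n, hy⟩, hxe.trans_le (hy.2 ⟨he.1, hn.le⟩)⟩

/-- Club guessing at points of countable cofinality. -/
theorem exists_isClubGuessing {κ : Cardinal.{u}} (hreg : κ.IsRegular) (hκ : ℵ₁ < κ) :
    ∃ (S : Set (Below κ)) (C : Below κ → Set (Below κ)), IsClubGuessing S C := by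
  have := noMaxOrder_below hreg
  have := nonempty_below hreg
  have hcof : ℵ₁ < cof (Below κ) := by
    rw [cof_below hreg, ← lift_aleph_one.{u, u + 1}, Cardinal.lift_lt]
    exact hκ
  have hω : ℵ₀ < cof (Below κ) := aleph0_lt_aleph_one.trans hcof
  let S : Set (Below κ) := {δ | ∃ a : ℕ → Below κ, StrictMono a ∧ IsLUB (range a) δ}
  have hex : ∀ δ, ∃ a : ℕ → Below κ, δ ∈ S → StrictMono a ∧ IsLUB (range a) δ := fun δ => by
    by_cases h : δ ∈ S
    · obtain ⟨a, ha⟩ := h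
      exact ⟨a, fun _ => ha⟩
    · exact ⟨fun _ => δ, fun h' => (h h').elim⟩
  choose a ha using hex
  have hlt : ∀ δ ∈ S, ∀ n, a δ n < δ := fun δ hδ n =>
    ((ha δ hδ).1 n.lt_succ_self).trans_le ((ha δ hδ).2.1 ⟨_, rfl⟩)
  obtain ⟨E, hE, hguess⟩ := exists_gluedLadder_subset hcof (S := S) (a := a) (by
    intro E hE
    obtain ⟨f, x, hf, -, hfE, hx⟩ := exists_strictMono_isLUB hω (P := fun _ b => b ∈ E)
      (fun c => by
        obtain ⟨c', hc'⟩ := exists_gt c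
        obtain ⟨b, hb, hb'⟩ := hE.isCofinal c'
        exact ⟨b, hc'.trans_le hb', hb⟩) (Classical.arbitrary (Below κ))
    refine ⟨x, ⟨f, hf, hx⟩, fun y hy => hy.2.le, fun b hb => hx.2 ?_⟩
    rintro _ ⟨n, rfl⟩
    have h1 : f n < f (n + 1) := hf n.lt_succ_self
    have h2 : f (n + 1) < x := (hf (n + 1).lt_succ_self).trans_le (hx.1 ⟨_, rfl⟩)
    exact h1.le.trans (hb ⟨hfE n, h2⟩))
  have hlub : ∀ δ ∈ S, IsLUB (E ∩ Iio δ) δ → IsLUB (gluedLadder E (a δ)) δ := fun δ hδ h =>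
    ⟨fun y hy => (gluedLadder_subset_Iio (hlt δ hδ) hy).le, fun b hb => by
      by_contra! hbδ
      obtain ⟨y, hy, hby⟩ := exists_gluedLadder_gt hE h (ha δ hδ).2 hbδ
      exact (hb hy).not_gt hby⟩
  have hstat : ∀ F : Set (Below κ), IsClub F →
      IsStationary {δ | δ ∈ S ∩ {δ | IsLUB (E ∩ Iio δ) δ} ∧ gluedLadder E (a δ) ⊆ F} := by
    intro F hF t ht
    -- Guessing inside `F ∩ t` yields stationarity: `δ` is a limit of its glued ladder, so it
    -- belongs to the club `t` itself.
    obtain ⟨δ, hδ, hδE, hsub⟩ := hguess _ (hF.inter hω.ne' ht)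
    refine ⟨δ, ⟨⟨hδ, hδE⟩, fun y hy => (hsub hy).1⟩, ht.isLUB_mem (fun y hy => (hsub hy).2) ?_
      (hlub δ hδ hδE)⟩
    obtain ⟨y, hy, -⟩ := exists_gluedLadder_gt hE hδE (ha δ hδ).2 (hlt δ hδ 0)
    exact ⟨y, hy⟩
  refine ⟨S ∩ {δ | IsLUB (E ∩ Iio δ) δ}, fun δ => gluedLadder E (a δ), ?_, ?_, ?_, ?_, hstat⟩
  · exact (hstat _ .univ).mono fun δ hδ => hδ.1
  · exact fun δ hδ => gluedLadder_subset_Iio (hlt δ hδ.1)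
  · exact fun δ hδ => hlub δ hδ.1 hδ.2
  · rintro δ ⟨hδ, hδE⟩
    have hgt := fun {x} => exists_gluedLadder_gt (x := x) hE hδE (ha δ hδ).2
    refine nonempty_orderIso_nat ?_ (fun x hx => hgt (gluedLadder_subset_Iio (hlt δ hδ) hx))
      fun x hx => gluedLadder_inter_Iio_finite (ha δ hδ).1.monotone hx
    obtain ⟨y, hy, -⟩ := hgt (hlt δ hδ 0)
    exact ⟨y, hy⟩

end ClubGuessing

/-! ### The guessing ideal is normal -/

section GuessingIdeal

open Order Set

variable {κ : Cardinal.{u}} {S : Set (Below κ)} {C : Below κ → Set (Below κ)}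

theorem AlmostSubset.mono {c E F : Set (Below κ)} (h : AlmostSubset c E) (hEF : E ⊆ F) :
    AlmostSubset c F := by
  obtain ⟨β, hβ, h⟩ := h
  exact ⟨β, hβ, fun γ hγ hle => hEF (h γ hγ hle)⟩

/-- The guessing ideal as an order ideal. -/
def guessingIdeal (hω : ℵ₀ < cof (Below κ)) (S : Set (Below κ))
    (C : Below κ → Set (Below κ)) : Order.Ideal (Set (Below κ)) where
  carrier := {X | GuessingNull S C X}
  lower' := by
    rintro X Y hYX ⟨E, hE, h⟩
    exact ⟨E, hE, fun δ hδ => h δ ⟨hδ.1, hYX hδ.2⟩⟩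
  nonempty' := ⟨∅, univ, .univ, fun δ hδ => hδ.2.elim⟩
  directed' := by
    rintro X ⟨E, hE, hX⟩ Y ⟨F, hF, hY⟩
    refine ⟨X ∪ Y, ⟨E ∩ F, hE.inter hω.ne' hF, ?_⟩, subset_union_left, subset_union_right⟩
    rintro δ ⟨⟨hS, hδE, hδF⟩, hδ | hδ⟩ h
    · exact hX δ ⟨⟨hS, hδE⟩, hδ⟩ (h.mono inter_subset_left)
    · exact hY δ ⟨⟨hS, hδF⟩, hδ⟩ (h.mono inter_subset_right)

theorem IsClubGuessing.nonempty (hC : IsClubGuessing S C) {δ : Below κ} (hδ : δ ∈ S) :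
    (C δ).Nonempty := by
  obtain ⟨f⟩ := hC.type_eq δ hδ
  exact ⟨f 0, (f 0).2⟩

theorem IsClubGuessing.exists_gt (hC : IsClubGuessing S C) {δ : Below κ} (hδ : δ ∈ S)
    {β : Below κ} (hβ : β < δ) : ∃ γ ∈ C δ, β < γ :=
  (lt_isLUB_iff (hC.isLUB δ hδ)).1 hβ

theorem isNormalIdeal_guessingIdeal (hreg : κ.IsRegular) (hω : ℵ₀ < cof (Below κ))
    (hC : IsClubGuessing S C) : IsNormalIdeal (guessingIdeal hω S C) := by
  have := noMaxOrder_below hreg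
  constructor
  · rintro ⟨E, hE, h⟩
    obtain ⟨δ, ⟨hδ, hsub⟩, hδE⟩ := hC.guess E hE hE
    obtain ⟨β, hβ⟩ := hC.nonempty hδ
    exact h δ ⟨⟨hδ, hδE⟩, trivial⟩ ⟨β, hβ, fun γ hγ _ => hsub hγ⟩
  · exact fun β => ⟨Ioi β, isClub_Ioi β, fun δ hδ => (lt_asymm (mem_Ioi.1 hδ.1.2) (mem_Iio.1 hδ.2)).elim⟩
  · intro F hF hFI
    choose E hE h using fun X : F => hFI X X.2
    refine ⟨⋂ X : F, E X, IsClub.iInter hω.ne' (by simpa [cof_below hreg] using hF) hE, ?_⟩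
    rintro δ ⟨⟨hS, hδE⟩, X, hX, hδ⟩ hsub
    exact h ⟨X, hX⟩ δ ⟨⟨hS, mem_iInter.1 hδE _⟩, hδ⟩ (hsub.mono (iInter_subset _ _))
  · intro X hX
    choose E hE h using hX
    refine ⟨_, isClub_diagonal hω (mk_Iio_lt_cof_below hreg) hE, ?_⟩
    rintro δ ⟨⟨hS, hδE⟩, α, hα, hδ⟩ ⟨β, hβ, hsub⟩
    -- Beyond `α`, membership in the diagonal intersection implies membership in `E α`, so the end
    -- segment is started above both `α` and `β`.
    obtain ⟨γ, hγ, hlt⟩ := hC.exists_gt hS (max_lt hα (hC.subset δ hS hβ))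
    refine h α δ ⟨⟨hS, hδE α hα⟩, hδ⟩ ⟨γ, hγ, fun ε hε hle => ?_⟩
    exact hsub ε hε ((le_max_right α β).trans (hlt.le.trans hle)) α
      ((le_max_left α β).trans_lt (hlt.trans_le hle))

end GuessingIdeal

/-! ### Traces of sequences along a ladder, modulo finite sets -/

section Traces

theorem modFin_iff {X Y : Set ℕ} : X ≈ Y ↔ ∃ N, ∀ n, N ≤ n → (n ∈ X ↔ n ∈ Y) := by
  change (symmDiff X Y).Finite ↔ _
  constructor
  · intro h
    obtain ⟨N, hN⟩ := h.bddAbove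
    refine ⟨N + 1, fun n hn => ?_⟩
    by_contra hcon
    have : n ∈ symmDiff X Y := by
      rw [Set.mem_symmDiff]
      tauto
    exact absurd (hN this) (by omega)
  · rintro ⟨N, hN⟩
    refine (Set.finite_Iio N).subset fun n hn => ?_
    by_contra hcon
    rw [Set.mem_symmDiff, hN n (not_lt.1 hcon)] at hn
    tauto

/-- An embedding of the subsets of `ℕ` into the infinite ones, modulo finite sets. -/
def padOdd (X : Set ℕ) : Set ℕ := {n | Odd n ∨ n / 2 ∈ X}

theorem padOdd_infinite (X : Set ℕ) : (padOdd X).Infinite :=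
  Set.infinite_of_forall_exists_gt fun n => ⟨2 * n + 1, Or.inl (by simp), by omega⟩

theorem not_padOdd_modFin_empty (X : Set ℕ) : ¬ padOdd X ≈ (∅ : Set ℕ) := by
  intro h
  obtain ⟨N, hN⟩ := modFin_iff.1 h
  obtain ⟨n, hn, hlt⟩ := (padOdd_infinite X).exists_gt N
  exact (hN n hlt.le).1 hn

theorem padOdd_modFin_padOdd {X Y : Set ℕ} (h : padOdd X ≈ padOdd Y) : X ≈ Y := by
  obtain ⟨N, hN⟩ := modFin_iff.1 h
  refine modFin_iff.2 ⟨N, fun n hn => ?_⟩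
  simpa [padOdd, Nat.not_odd_iff_even.2 (even_two_mul n)] using hN (2 * n) (by omega)

variable {L : Type v} [LinearOrder L]

/-- The set of those intervals of the ladder `a` which are visited by the sequence `x`. -/
def trace (a x : ℕ → L) : Set ℕ := {n | ∃ k, a n ≤ x k ∧ x k < a (n + 1)}

/-- The ladder intervals are pairwise disjoint, so each of the first `K` terms lies in at most one
of them. -/
theorem exists_forall_not_mem_interval {a : ℕ → L} (ha : Monotone a) (x : ℕ → L) (K : ℕ) :
    ∃ M, ∀ n, M ≤ n → ∀ k < K, ¬ (a n ≤ x k ∧ x k < a (n + 1)) := by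
  have hfin : (⋃ k ∈ Set.Iio K, {n | a n ≤ x k ∧ x k < a (n + 1)}).Finite := by
    refine (Set.finite_Iio K).biUnion fun k _ => Set.Subsingleton.finite ?_
    rintro m ⟨hm, hm'⟩ n ⟨hn, hn'⟩
    have h1 := ha.reflect_lt (hm.trans_lt hn')
    have h2 := ha.reflect_lt (hn.trans_lt hm')
    omega
  obtain ⟨M, hM⟩ := hfin.bddAbove
  refine ⟨M + 1, fun n hn k hk h => ?_⟩
  exact absurd (hM (Set.mem_biUnion (x := k) hk h)) (by omega)

theorem trace_tail_modFin {a : ℕ → L} (ha : Monotone a) (x : ℕ → L) (m : ℕ) :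
    trace a x ≈ trace a fun k => x (m + k) := by
  obtain ⟨M, hM⟩ := exists_forall_not_mem_interval ha x m
  refine modFin_iff.2 ⟨M, fun n hn => ⟨?_, fun ⟨k, hk⟩ => ⟨_, hk⟩⟩⟩
  rintro ⟨k, hk⟩
  refine ⟨k - m, ?_⟩
  simpa only [Nat.add_sub_cancel' (not_lt.1 fun h => hM n hn k h hk)] using hk

theorem Ray.TailEquiv.trace_modFin {V : Type u} {G : SimpleGraph V} {R S : Ray G}
    (h : R.TailEquiv S) {a : ℕ → L} (ha : Monotone a) (g : V → L) :
    trace a (fun k => g (R.vert k)) ≈ trace a fun k => g (S.vert k) := by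
  obtain ⟨m, n, h⟩ := h
  refine Setoid.trans (trace_tail_modFin ha _ m)
    (Setoid.trans ?_ (Setoid.symm (trace_tail_modFin ha _ n)))
  simp only [h]
  exact Setoid.refl _

end Traces

/-! ### Elements coded by a labelled graph -/

section Codes

variable {V : Type u} {W : Type w} {L : Type v} [LinearOrder L]

/-- The image, under a copy, of a ray in the neighbourhood of a vertex. -/
def Ray.mapNeighbor {G : SimpleGraph V} {H : SimpleGraph W} (f : SimpleGraph.Copy G H) {x : V}
    (R : Ray (G.induce (G.neighborSet x))) : Ray (H.induce (H.neighborSet (f x))) where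
  vert n := ⟨f (R.vert n), f.toHom.map_adj (R.vert n).2⟩
  injective _ _ h := R.injective <| Subtype.ext <| f.injective <| congrArg Subtype.val h
  adj n := f.toHom.map_adj (R.adj n)

theorem InClass.of_copy {G : SimpleGraph V} {H : SimpleGraph W} (f : SimpleGraph.Copy G H)
    (hH : InClass H) : InClass G := by
  intro x R S
  obtain ⟨m, n, h⟩ := hH _ (R.mapNeighbor f) (S.mapNeighbor f)
  exact ⟨m, n, fun k => Subtype.ext <| f.injective <| congrArg Subtype.val (h k)⟩

/-- The elements of `P(ω)/fin` which are coded, along the ladder `a`, by a ray in the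
neighbourhood of a vertex of the graph `G` labelled by `g`. -/
def codes (G : SimpleGraph V) (g : V → L) (a : ℕ → L) : Set PowModFin :=
  {z | ∃ (x : V) (R : Ray (G.induce (G.neighborSet x))) (X : Set ℕ), z = ⟦X⟧ ∧
    trace a (fun k => g (R.vert k)) ≈ padOdd X}

/-- A vertex codes at most one element, since all rays in its neighbourhood are tail-equivalent; so
choosing a coding vertex is injective. -/
theorem mk_codes_le {G : SimpleGraph V} (hG : InClass G) (g : V → L) {a : ℕ → L}
    (ha : Monotone a) : Cardinal.lift.{u} #(codes G g a) ≤ Cardinal.lift.{0} #V := by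
  choose x R X hX hR using fun z : codes G g a => z.2
  refine Cardinal.lift_mk_le_lift_mk_of_injective (f := x) fun y z h => Subtype.ext ?_
  rw [hX, hX]
  refine Quotient.sound (padOdd_modFin_padOdd ?_)
  have key : ∀ x' x'' (_ : x' = x'') (R' : Ray (G.induce (G.neighborSet x')))
      (R'' : Ray (G.induce (G.neighborSet x''))),
      trace a (fun k => g (R'.vert k)) ≈ trace a fun k => g (R''.vert k) := by
    rintro x' _ rfl R' R''
    exact (hG x' R' R'').trace_modFin ha fun y => g y
  exact Setoid.trans (Setoid.symm (hR y)) (Setoid.trans (key _ _ h (R y) (R z)) (hR z))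

/-- Lying in a ladder interval is decided by the cuts at its two ends. If the copy respects the cuts
from `N` on, a ray and its image have traces that agree from `N` on. -/
theorem codes_subset_of_copy {G : SimpleGraph V} {H : SimpleGraph W} (f : SimpleGraph.Copy G H)
    {g : V → L} {h : W → L} {a : ℕ → L} {N : ℕ}
    (hN : ∀ n, N ≤ n → ∀ x, g x < a n ↔ h (f x) < a n) : codes G g a ⊆ codes H h a := by
  rintro _ ⟨x, R, X, rfl, hR⟩
  refine ⟨f x, R.mapNeighbor f, X, rfl, Setoid.trans (modFin_iff.2 ⟨N, fun n hn => ?_⟩) hR⟩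
  refine exists_congr fun k => ?_
  rw [← not_lt, ← not_lt]
  change ¬ h (f (R.vert k)) < _ ∧ h (f (R.vert k)) < _ ↔ _
  rw [hN n hn, hN (n + 1) (by omega)]

end Codes

/-! ### The tree of lists with an apex over each chosen branch -/

section BranchGraph

variable {A : Type v} {ι : Type w}

/-- The initial segments of a sequence, as lists with the last element first. -/
def initialList (b : ℕ → A) : ℕ → List A
  | 0 => []
  | n + 1 => b n :: initialList b n

@[simp]
theorem length_initialList (b : ℕ → A) (n : ℕ) : (initialList b n).length = n := by
  induction n with
  | zero => rfl
  | succ n ih => simp [initialList, ih]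

theorem mem_initialList {b : ℕ → A} {n : ℕ} {x : A} :
    x ∈ initialList b n ↔ ∃ j < n, b j = x := by
  induction n with
  | zero => simp [initialList]
  | succ n ih =>
    simp only [initialList, List.mem_cons, ih, Nat.lt_succ_iff_lt_or_eq]
    constructor
    · rintro (rfl | ⟨j, hj, rfl⟩)
      exacts [⟨n, .inr rfl, rfl⟩, ⟨j, .inl hj, rfl⟩]
    · rintro ⟨j, hj | rfl, rfl⟩
      exacts [.inr ⟨j, hj, rfl⟩, .inl rfl]

/-- The edges of the tree of lists, and those from the index of a branch to its nodes. -/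
inductive BranchRel (b : ι → ℕ → A) : List A ⊕ ι → List A ⊕ ι → Prop
  | cons (x : A) (l : List A) : BranchRel b (.inl l) (.inl (x :: l))
  | branch (i : ι) (n : ℕ) : BranchRel b (.inr i) (.inl (initialList (b i) n))

/-- The tree of lists together with a vertex, joined to the whole branch, for every branch from a
given family. -/
def branchGraph (b : ι → ℕ → A) : SimpleGraph (List A ⊕ ι) :=
  SimpleGraph.fromRel (BranchRel b)

variable {b : ι → ℕ → A}

theorem branchGraph_adj_inl_inl {l m : List A} : (branchGraph b).Adj (.inl l) (.inl m) ↔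
    (∃ x, m = x :: l) ∨ ∃ x, l = x :: m := by
  simp only [branchGraph, SimpleGraph.fromRel_adj]
  constructor
  · rintro ⟨-, h | h⟩
    · cases h
      exact .inl ⟨_, rfl⟩
    · cases h
      exact .inr ⟨_, rfl⟩
  · rintro (⟨x, rfl⟩ | ⟨x, rfl⟩)
    · exact ⟨by simp, .inl (.cons _ _)⟩
    · exact ⟨by simp, .inr (.cons _ _)⟩

theorem branchGraph_adj_inr_inl {i : ι} {l : List A} :
    (branchGraph b).Adj (.inr i) (.inl l) ↔ l = initialList (b i) l.length := by
  simp only [branchGraph, SimpleGraph.fromRel_adj]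
  constructor
  · rintro ⟨-, h | h⟩
    · generalize hl : (Sum.inl l : List A ⊕ ι) = y at h
      cases h
      cases hl
      simp
    · cases h
  · intro h
    rw [h]
    exact ⟨by simp, .inl (.branch i _)⟩

theorem branchGraph_not_adj_inr_inr {i j : ι} : ¬ (branchGraph b).Adj (.inr i) (.inr j) := by
  simp only [branchGraph, SimpleGraph.fromRel_adj]
  rintro ⟨-, h | h⟩ <;> cases h

/-- An injective walk cannot reverse direction, so a single step down would force an infinite
descent in `ℕ`. -/
theorem eq_add_of_injective_of_step {k : ℕ → ℕ} (hinj : Function.Injective k)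
    (hstep : ∀ n, k (n + 1) = k n + 1 ∨ k n = k (n + 1) + 1) (n : ℕ) : k n = k 0 + n := by
  have hup : ∀ n, k (n + 1) = k n + 1 := by
    intro n
    refine (hstep n).resolve_right fun hdown => ?_
    have hall : ∀ j, k (n + j) = k (n + j + 1) + 1 := by
      intro j
      induction j with
      | zero => exact hdown
      | succ j ih =>
        refine (hstep (n + (j + 1))).resolve_left fun h => ?_
        have := hinj (h.trans (by rw [← add_assoc, ← ih]) : k (n + (j + 1) + 1) = k (n + j))
        omega
    have hsum : ∀ j, k (n + j) + j = k n := by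
      intro j
      induction j with
      | zero => rfl
      | succ j ih =>
        have := hall j
        rw [add_assoc] at this
        omega
    have := hsum (k n + 1)
    omega
  induction n with
  | zero => rfl
  | succ n ih => rw [hup, ih, add_assoc]

theorem exists_ray_eq_initialList {i : ι}
    (R : Ray ((branchGraph b).induce ((branchGraph b).neighborSet (.inr i)))) :
    ∃ m, ∀ n, (R.vert n : List A ⊕ ι) = .inl (initialList (b i) (m + n)) := by
  have hex : ∀ n, ∃ k, (R.vert n : List A ⊕ ι) = .inl (initialList (b i) k) := by
    intro n
    have hadj : (branchGraph b).Adj (.inr i) (R.vert n) := (R.vert n).2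
    generalize (R.vert n : List A ⊕ ι) = y at hadj
    rcases y with l | j
    · exact ⟨l.length, congrArg _ (branchGraph_adj_inr_inl.1 hadj)⟩
    · exact (branchGraph_not_adj_inr_inr hadj).elim
  choose k hk using hex
  refine ⟨k 0, fun n => ?_⟩
  rw [hk, eq_add_of_injective_of_step (k := k) (fun m n h => R.injective (Subtype.ext ?_))
    (fun n => ?_) n]
  · rw [hk, hk, h]
  · have hadj : (branchGraph b).Adj (R.vert n) (R.vert (n + 1)) := R.adj n
    rw [hk, hk, branchGraph_adj_inl_inl] at hadj
    rcases hadj with ⟨x, h⟩ | ⟨x, h⟩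
    · exact .inl (by simpa using congrArg List.length h)
    · exact .inr (by simpa using congrArg List.length h)

/-- The ray in the neighbourhood of the index of a branch. -/
def branchRay (b : ι → ℕ → A) (i : ι) :
    Ray ((branchGraph b).induce ((branchGraph b).neighborSet (.inr i))) where
  vert n := ⟨.inl (initialList (b i) n), branchGraph_adj_inr_inl.2 (by simp)⟩
  injective m n h := by
    have := congrArg List.length (Sum.inl.inj (congrArg Subtype.val h))
    simpa using this
  adj n := branchGraph_adj_inl_inl.2 (.inl ⟨b i n, rfl⟩)

/-- Apart from its parent, a node has only children and apices as neighbours. No two children and no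
two apices are adjacent, and an apex sees just one child, the next node of its branch, so it cannot
be an inner vertex of a path. -/
theorem not_exists_path_in_neighborSet_inl {l : List A} {r : ℕ → List A ⊕ ι}
    (hinj : Function.Injective r) (hl : ∀ n, (branchGraph b).Adj (.inl l) (r n))
    (hadj : ∀ n, (branchGraph b).Adj (r n) (r (n + 1)))
    (hparent : ∀ n m x, r n = .inl m → l ≠ x :: m) : False := by
  have hchild : ∀ n m, r n = .inl m → ∃ x, m = x :: l := by
    intro n m h
    have := hl n
    rw [h, branchGraph_adj_inl_inl] at this
    exact this.resolve_right fun ⟨x, hx⟩ => hparent n m x h hx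
  have hstar : ∀ n i, r (n + 1) ≠ .inr i := by
    intro n i hi
    have hend : ∀ j, (branchGraph b).Adj (r (n + 1)) (r j) →
        r j = .inl (initialList (b i) (l.length + 1)) := by
      intro j hj
      rcases hrj : r j with m | i'
      · rw [hi, hrj, branchGraph_adj_inr_inl] at hj
        obtain ⟨x, hx⟩ := hchild j m hrj
        rw [hj, hx, List.length_cons]
      · rw [hi, hrj] at hj
        exact (branchGraph_not_adj_inr_inr hj).elim
    have := hinj ((hend n (hadj n).symm).trans (hend (n + 2) (hadj (n + 1))).symm)
    omega
  rcases h1 : r 1 with m | i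
  · rcases h2 : r 2 with m' | i
    · obtain ⟨x, hx⟩ := hchild 1 m h1
      obtain ⟨x', hx'⟩ := hchild 2 m' h2
      have := hadj 1
      rw [h1, h2, branchGraph_adj_inl_inl] at this
      rcases this with ⟨y, h⟩ | ⟨y, h⟩ <;> simpa [hx, hx'] using congrArg List.length h
    · exact hstar 1 i h2
  · exact hstar 0 i h1

theorem isEmpty_ray_neighborSet_inl {l : List A} :
    IsEmpty (Ray ((branchGraph b).induce ((branchGraph b).neighborSet (.inl l)))) := by
  refine ⟨fun R => ?_⟩
  have hinj : Function.Injective fun n => (R.vert n : List A ⊕ ι) :=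
    Subtype.val_injective.comp R.injective
  obtain ⟨N, hN⟩ : ∃ N, ∀ n m x, (R.vert (N + n) : List A ⊕ ι) = .inl m → l ≠ x :: m := by
    by_cases h : ∃ n m x, (R.vert n : List A ⊕ ι) = .inl m ∧ l = x :: m
    · obtain ⟨N, m, x, hm, hl⟩ := h
      -- By injectivity the ray meets the parent of `l` at most once; start after that visit.
      refine ⟨N + 1, fun n m' x' hm' hl' => ?_⟩
      obtain ⟨-, rfl⟩ := List.cons.inj (hl.symm.trans hl')
      have := hinj (hm.trans hm'.symm)
      omega
    · push Not at h
      exact ⟨0, fun n m x => h _ m x⟩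
  exact not_exists_path_in_neighborSet_inl (r := fun n => (R.vert (N + n) : List A ⊕ ι))
    (fun m n h => Nat.add_left_cancel (hinj h)) (fun n => (R.vert (N + n)).2)
    (fun n => R.adj (N + n)) hN

theorem inClass_branchGraph (b : ι → ℕ → A) : InClass (branchGraph b) := by
  rintro (l | i) R S
  · exact (isEmpty_ray_neighborSet_inl.false R).elim
  · obtain ⟨m, hm⟩ := exists_ray_eq_initialList R
    obtain ⟨n, hn⟩ := exists_ray_eq_initialList S
    refine ⟨n, m, fun k => Subtype.ext ?_⟩
    rw [hm, hn, add_left_comm]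

variable [LinearOrder A]

theorem mem_codes_branchGraph {g : List A ⊕ ι → A} {a : ℕ → A} (ha : Monotone a) {z : PowModFin} :
    z ∈ codes (branchGraph b) g a ↔ ∃ (i : ι) (X : Set ℕ), z = ⟦X⟧ ∧
      trace a (fun k => g (.inl (initialList (b i) k))) ≈ padOdd X := by
  constructor
  · rintro ⟨l | i, R, X, hz, hR⟩
    · exact (isEmpty_ray_neighborSet_inl.false R).elim
    · exact ⟨i, X, hz, Setoid.trans ((inClass_branchGraph b _ (branchRay b i) R).trace_modFin ha
        fun y => g y) hR⟩
  · rintro ⟨i, X, hz, hR⟩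
    exact ⟨_, branchRay b i, X, hz, hR⟩

variable {g : List A → A} {a c : ℕ → A} {N : ℕ} {δ ε : A}

theorem mem_trace_initialList (hN : ∀ n, N ≤ n → ∀ l, g l < a n ↔ ∀ x ∈ l, x < a n) {n : ℕ}
    (hn : N ≤ n) : n ∈ trace a (fun k => g (initialList c k)) ↔
      ∃ k, (∃ j < k, a n ≤ c j) ∧ ∀ j < k, c j < a (n + 1) := by
  refine exists_congr fun k => ?_
  rw [hN (n + 1) (by omega), ← not_lt, hN n hn]
  simp [mem_initialList]

/-- At late cuts a node behaves like its largest entry. Along this branch the largest entries are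
the ladder points with index in `X`, and `a n` lies in the interval numbered `n`. -/
theorem trace_initialList_modFin (hN : ∀ n, N ≤ n → ∀ l, g l < a n ↔ ∀ x ∈ l, x < a n)
    (ha : StrictMono a) {X : Set ℕ} (hX : X.Infinite) :
    trace a (fun k => g (initialList (fun j => a (Nat.nth (· ∈ X) j)) k)) ≈ X := by
  refine modFin_iff.2 ⟨N, fun n hn => ?_⟩
  rw [mem_trace_initialList hN hn]
  simp only [ha.le_iff_le, ha.lt_iff_lt, Nat.lt_succ_iff]
  constructor
  · rintro ⟨k, ⟨j, hj, hle⟩, h⟩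
    rw [le_antisymm hle (h j hj)]
    exact Nat.nth_mem_of_infinite hX j
  · intro h
    obtain ⟨j, rfl⟩ : n ∈ Set.range (Nat.nth (· ∈ X)) := by
      rw [Nat.range_nth_of_infinite (p := (· ∈ X)) hX]
      exact h
    exact ⟨j + 1, ⟨j, j.lt_succ_self, le_rfl⟩,
      fun i hi => (Nat.nth_strictMono hX).monotone (Nat.lt_succ_iff.1 hi)⟩

/-- If `ε < δ`, the entries stay below some ladder point. If `ε > δ`, some entry exceeds `δ`; all
nodes containing it miss the late intervals, and only finitely many nodes precede it. -/
theorem trace_initialList_modFin_empty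
    (hN : ∀ n, N ≤ n → ∀ l, g l < a n ↔ ∀ x ∈ l, x < a n) (ha : StrictMono a)
    (haδ : IsLUB (Set.range a) δ) (hcε : IsLUB (Set.range c) ε) (hne : ε ≠ δ) :
    trace a (fun k => g (initialList c k)) ≈ (∅ : Set ℕ) := by
  rcases hne.lt_or_gt with h | h
  · obtain ⟨_, ⟨M, rfl⟩, hM⟩ := (lt_isLUB_iff haδ).1 h
    refine modFin_iff.2 ⟨max N M, fun n hn => iff_of_false (fun hmem => ?_) id⟩
    obtain ⟨k, ⟨j, -, hj⟩, -⟩ := (mem_trace_initialList hN (by omega)).1 hmem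
    exact (hM.trans_le ((ha.monotone (by omega)).trans hj)).not_ge (hcε.1 ⟨j, rfl⟩)
  · obtain ⟨_, ⟨J, rfl⟩, hJ⟩ := (lt_isLUB_iff hcε).1 h
    obtain ⟨M, hM⟩ := exists_forall_not_mem_interval ha.monotone
      (fun k => g (initialList c k)) (J + 1)
    refine modFin_iff.2 ⟨max N M, fun n hn => iff_of_false ?_ id⟩
    rintro ⟨k, hk⟩
    refine hM n (by omega) k (not_le.1 fun hJk => ?_) hk
    have := (hN (n + 1) (by omega) _).1 hk.2 _ (mem_initialList.2 ⟨J, by omega, rfl⟩)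
    exact (hJ.trans this).not_ge (haδ.1 ⟨_, rfl⟩)

end BranchGraph

/-! ### Reduced powers and positive parts -/

section ReducedPower

variable {κ : Cardinal.{u}} {I : Order.Ideal (Set (Below κ))} {A B : Type v}

theorem eventually_dualFilter {p : Below κ → Prop} :
    (∀ᶠ δ in dualFilter I, p δ) ↔ {δ | ¬ p δ} ∈ I := Iff.rfl

theorem positivePart_mono {s t : Below κ → SmallSubsets A κ}
    (h : ∀ᶠ δ in dualFilter I, s δ ≤ t δ) : positivePart I s ⊆ positivePart I t := by
  intro x hx hxt
  refine hx (I.lower ?_ (I.sup_mem hxt (eventually_dualFilter.1 h)))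
  intro δ hδ
  by_cases hle : s δ ≤ t δ
  · exact .inl (hle hδ)
  · exact .inr hle

/-- A positive element occurs in some coordinate, so the positive part lies in a union of `κ` sets
of size at most `κ`. -/
theorem mk_positivePart_le (hκ : ℵ₀ ≤ κ) (s : Below κ → SmallSubsets A κ) :
    Cardinal.lift.{u} #(positivePart I s) ≤ Cardinal.lift.{v} κ := by
  have hex : ∀ x : positivePart I s, ∃ δ, x.1 ∈ (s δ).1 := fun x => by
    by_contra! h
    refine x.2 ?_
    have : {δ | x.1 ∈ (s δ).1} = ∅ := Set.eq_empty_of_forall_notMem h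
    rw [this]
    exact I.bot_mem
  choose d hd using hex
  have hlabel : ∀ δ, Nonempty ((s δ).1 ↪ κ.out) := fun δ =>
    Cardinal.lift_mk_le'.1 (by simpa using (s δ).2)
  let l := fun δ => (hlabel δ).some
  have hinj : Function.Injective fun x : positivePart I s => (d x, l (d x) ⟨x, hd x⟩) := by
    intro x y h
    have h1 : d x = d y := congrArg Prod.fst h
    have h2 := congrArg Prod.snd h
    have key : ∀ δ (hδ : d y = δ) (hx : x.1 ∈ (s δ).1),
        l δ ⟨x, hx⟩ = l (d y) ⟨y, hd y⟩ → x.1 = y.1 := by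
      rintro _ rfl hx h
      exact Subtype.mk.inj ((l _).injective h)
    exact Subtype.ext (key _ h1.symm _ h2)
  have := Cardinal.lift_mk_le_lift_mk_of_injective hinj
  simp only [mk_prod, mk_below, mk_out, Cardinal.lift_mul, Cardinal.lift_lift] at this
  rw [Cardinal.mul_eq_self (by simpa using hκ)] at this
  rw [← Cardinal.lift_le.{u + 1}]
  simpa using this

/-- The homomorphism sending the class of a sequence to its positive part. -/
noncomputable def positivePartHom (hκ : ℵ₀ ≤ κ) : ReducedPower A I →o SmallSubsets A κ where
  toFun f := f.liftOn (fun s => ⟨positivePart I s, mk_positivePart_le hκ s⟩) fun _ _ h =>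
    Subtype.ext ((positivePart_mono (h.mono fun _ => le_of_eq)).antisymm
      (positivePart_mono (h.mono fun _ => ge_of_eq)))
  monotone' f g := by
    induction f using Filter.Germ.inductionOn with
    | h s =>
      induction g using Filter.Germ.inductionOn with
      | h t => exact positivePart_mono

theorem positivePartHom_coe (hκ : ℵ₀ ≤ κ) (s : Below κ → SmallSubsets A κ) :
    (positivePartHom hκ (s : ReducedPower A I) : Set A) = positivePart I s := rfl

theorem positivePartHom_surjective (hκ : ℵ₀ ≤ κ) (hI : Set.univ ∉ I) :
    Function.Surjective (positivePartHom hκ : ReducedPower A I →o SmallSubsets A κ) := by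
  intro B
  refine ⟨((fun _ => B : Below κ → SmallSubsets A κ) : ReducedPower A I), Subtype.ext ?_⟩
  rw [positivePartHom_coe]
  ext x
  by_cases hx : x ∈ B.1
  · simpa [positivePart, hx] using hI
  · simpa [positivePart, hx] using I.bot_mem

/-- A bijection acts on the small subsets. -/
def smallSubsetsIso (e : A ≃ B) (κ : Cardinal.{u}) : SmallSubsets A κ ≃o SmallSubsets B κ where
  toFun s := ⟨e '' s.1, by
    rw [Cardinal.mk_image_eq e.injective]
    exact s.2⟩
  invFun s := ⟨e.symm '' s.1, by
    rw [Cardinal.mk_image_eq e.symm.injective]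
    exact s.2⟩
  left_inv s := Subtype.ext (e.symm_image_image s.1)
  right_inv s := Subtype.ext (e.image_symm_image s.1)
  map_rel_iff' := Set.image_subset_image_iff e.injective

/-- A bijection acts on the reduced powers. -/
def reducedPowerHom (I : Order.Ideal (Set (Below κ))) (e : A ≃ B) :
    ReducedPower A I →o ReducedPower B I where
  toFun := Filter.Germ.map (smallSubsetsIso e κ)
  monotone' f g := by
    induction f using Filter.Germ.inductionOn with
    | h s =>
      induction g using Filter.Germ.inductionOn with
      | h t => exact fun h => Filter.Eventually.mono h fun δ hδ =>
          (smallSubsetsIso e κ).monotone hδ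

theorem reducedPowerHom_surjective (e : A ≃ B) :
    Function.Surjective (reducedPowerHom I e) := by
  intro f
  induction f using Filter.Germ.inductionOn with
  | h s =>
    refine ⟨((fun δ => (smallSubsetsIso e κ).symm (s δ) : Below κ → SmallSubsets A κ) :
      ReducedPower A I), congrArg Filter.Germ.ofFun (funext fun δ => ?_)⟩
    exact (smallSubsetsIso e κ).apply_symm_apply (s δ)

theorem positivePartHom_reducedPowerHom (hκ : ℵ₀ ≤ κ) (e : A ≃ B) (f : ReducedPower A I) :
    positivePartHom hκ (reducedPowerHom I e f) = smallSubsetsIso e κ (positivePartHom hκ f) := by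
  induction f using Filter.Germ.inductionOn with
  | h s =>
    refine Subtype.ext ?_
    change positivePart I (fun δ => smallSubsetsIso e κ (s δ)) = e '' positivePart I s
    ext x
    obtain ⟨y, rfl⟩ := e.surjective x
    rw [e.injective.mem_set_image]
    change {δ | e y ∈ e '' (s δ).1} ∉ I ↔ {δ | y ∈ (s δ).1} ∉ I
    simp only [e.injective.mem_set_image]

end ReducedPower

/-! ### The cardinality of `P(ω)/fin` -/

section PowModFin

theorem mk_powModFin : #PowModFin = 𝔠 := by
  apply le_antisymm
  · refine (mk_quotient_le (s := modFinSetoid)).trans ?_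
    simp
  -- Replacing each point by an infinite column makes distinct sets differ infinitely often.
  · have hinj : Function.Injective fun X : Set ℕ => (⟦{n | n.unpair.1 ∈ X}⟧ : PowModFin) := by
      intro X Y h
      obtain ⟨N, hN⟩ := modFin_iff.1 (Quotient.exact h)
      ext n
      simpa using hN (Nat.pair n N) (Nat.right_le_pair n N)
    have hle : #(Set ℕ) ≤ #PowModFin := mk_le_of_injective hinj
    simpa using hle

theorem nonempty_powModFin_equiv_real : Nonempty (PowModFin ≃ ℝ) :=
  Cardinal.eq.1 (mk_powModFin.trans mk_real.symm)

end PowModFin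

/-! ### The coding homomorphism and its surjectivity -/

section CodeHom

variable {κ : Cardinal.{u}}

theorem ClassGraph.nonempty_equiv_below (G : ClassGraph κ) : Nonempty (G.V ≃ Below κ) :=
  Cardinal.lift_mk_eq'.1 (by rw [mk_below, G.card_eq, Cardinal.lift_lift])

/-- A labelling of the vertices of a graph by the ordinals below its cardinality. -/
noncomputable def ClassGraph.label (G : ClassGraph κ) : G.V ≃ Below κ :=
  G.nonempty_equiv_below.some

/-- The sequence of sets coded by a graph along the ladders `a δ`. -/
noncomputable def ClassGraph.codeSeq (G : ClassGraph κ) {a : Below κ → ℕ → Below κ}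
    (ha : ∀ δ, Monotone (a δ)) (δ : Below κ) : SmallSubsets PowModFin κ :=
  ⟨codes G.graph G.label (a δ), by
    simpa [G.card_eq] using mk_codes_le G.inClass G.label (ha δ)⟩

theorem exists_classGraph {W : Type w} {G : SimpleGraph W} (hG : InClass G)
    (hW : Cardinal.lift.{u} #W = Cardinal.lift.{w} κ) :
    ∃ H : ClassGraph κ, Nonempty (G ≃g H.graph) := by
  obtain ⟨e⟩ : Nonempty (W ≃ κ.out) := Cardinal.lift_mk_eq'.1 (by simpa using hW)
  exact ⟨⟨κ.out, G.map e.toEmbedding, by simp,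
    hG.of_copy (SimpleGraph.Iso.map e G).symm.toCopy⟩, ⟨SimpleGraph.Iso.map e G⟩⟩

/-- The ladders `a δ`, for `δ ∈ S`, enumerate the sets `C δ`. -/
structure Enumerates (S : Set (Below κ)) (C : Below κ → Set (Below κ))
    (a : Below κ → ℕ → Below κ) : Prop where
  monotone : ∀ δ, Monotone (a δ)
  strictMono : ∀ δ ∈ S, StrictMono (a δ)
  range_eq : ∀ δ ∈ S, Set.range (a δ) = C δ

variable {S : Set (Below κ)} {C : Below κ → Set (Below κ)} {a : Below κ → ℕ → Below κ}

theorem IsClubGuessing.exists_enumerates (hC : IsClubGuessing S C) :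
    ∃ a, Enumerates S C a := by
  have hex : ∀ δ, ∃ a : ℕ → Below κ, Monotone a ∧
      (δ ∈ S → StrictMono a ∧ Set.range a = C δ) := by
    intro δ
    by_cases hδ : δ ∈ S
    · obtain ⟨f⟩ := hC.type_eq δ hδ
      have hf : StrictMono fun n => (f n : Below κ) := fun m n h => f.strictMono h
      refine ⟨fun n => f n, hf.monotone, fun _ => ⟨hf, ?_⟩⟩
      change Set.range (Subtype.val ∘ f) = C δ
      rw [Set.range_comp, f.surjective.range_eq, Set.image_univ, Subtype.range_coe]
    · exact ⟨fun _ => δ, monotone_const, fun h => (hδ h).elim⟩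
  choose a ha using hex
  exact ⟨a, fun δ => (ha δ).1, fun δ hδ => ((ha δ).2 hδ).1, fun δ hδ => ((ha δ).2 hδ).2⟩

theorem Enumerates.exists_forall_mem (ha : Enumerates S C a) {δ : Below κ} (hδ : δ ∈ S)
    {E : Set (Below κ)} (h : AlmostSubset (C δ) E) : ∃ N, ∀ n, N ≤ n → a δ n ∈ E := by
  obtain ⟨β, hβ, h⟩ := h
  rw [← ha.range_eq δ hδ] at hβ h
  obtain ⟨N, rfl⟩ := hβ
  exact ⟨N, fun n hn => h _ ⟨n, rfl⟩ (ha.monotone δ hn)⟩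

theorem eventually_of_isClub (ha : Enumerates S C a) (hω : ℵ₀ < Order.cof (Below κ))
    {E : Set (Below κ)} (hE : IsClub E) {p : Below κ → Prop}
    (h : ∀ δ ∈ S, ∀ N, (∀ n, N ≤ n → a δ n ∈ E) → p δ) :
    ∀ᶠ δ in dualFilter (guessingIdeal hω S C), p δ := by
  refine eventually_dualFilter.2 ⟨E, hE, fun δ hδ hsub => hδ.2 ?_⟩
  obtain ⟨N, hN⟩ := ha.exists_forall_mem hδ.1.1 hsub
  exact h δ hδ.1.1 N hN

theorem mk_fiber_lt_of_injective (hω : ℵ₀ < Order.cof (Below κ)) {V : Type v} {p : V → Below κ}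
    (hp : Function.Injective p) (x : Below κ) :
    Cardinal.lift.{u + 1} #{w // p w = x} < Cardinal.lift.{v} (Order.cof (Below κ)) := by
  have : Subsingleton {w // p w = x} := ⟨fun y z => Subtype.ext (hp (y.2.trans z.2.symm))⟩
  refine lt_of_le_of_lt (Cardinal.lift_le.2 (le_one_iff_subsingleton.2 this)) ?_
  rw [Cardinal.lift_one]
  exact Cardinal.one_lt_lift_iff.2 (one_lt_aleph0.trans hω)

theorem codeSeq_eventually_le (hreg : κ.IsRegular) (hω : ℵ₀ < Order.cof (Below κ))
    (ha : Enumerates S C a) {G H : ClassGraph κ} (h : SimpleGraph.IsContained G.graph H.graph) :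
    ∀ᶠ δ in dualFilter (guessingIdeal hω S C),
      G.codeSeq ha.monotone δ ≤ H.codeSeq ha.monotone δ := by
  obtain ⟨f⟩ := h
  have := noMaxOrder_below hreg
  have hsmall := mk_Iio_lt_cof_below hreg
  refine eventually_of_isClub ha hω
    ((isClub_closed hω hsmall (p := G.label) (q := fun x => H.label (f x))
      (mk_fiber_lt_of_injective hω G.label.injective)).inter hω.ne'
    (isClub_closed hω hsmall (p := fun x => H.label (f x)) (q := G.label)
      (mk_fiber_lt_of_injective hω (H.label.injective.comp f.injective)))) ?_
  intro δ hδ N hN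
  exact codes_subset_of_copy f fun n hn x => ⟨(hN n hn).1 x, (hN n hn).2 x⟩

/-- The homomorphism sending the isomorphism type of a graph to the class of the sequence of the
sets coded by it. -/
noncomputable def codeHom (hreg : κ.IsRegular) (hω : ℵ₀ < Order.cof (Below κ))
    (ha : Enumerates S C a) : IsoTypes κ →o ReducedPower PowModFin (guessingIdeal hω S C) where
  toFun t := ((Quotient.out t).codeSeq ha.monotone : ReducedPower _ _)
  monotone' s t hst := by
    rw [← Quotient.out_eq s, ← Quotient.out_eq t] at hst
    exact codeSeq_eventually_le hreg hω ha hst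

/-- The representative and `G` embed in each other, so antisymmetry of the reduced power removes the
dependence on representative and labelling. -/
theorem codeHom_mk (hreg : κ.IsRegular) (hω : ℵ₀ < Order.cof (Below κ))
    (ha : Enumerates S C a) (G : ClassGraph κ) :
    codeHom hreg hω ha ⟦G⟧ = (G.codeSeq ha.monotone : ReducedPower _ _) := by
  obtain ⟨e⟩ : (⟦G⟧ : IsoTypes κ).out ≈ G := Quotient.mk_out G
  exact le_antisymm (codeSeq_eventually_le hreg hω ha ⟨e.toCopy⟩)
    (codeSeq_eventually_le hreg hω ha ⟨e.symm.toCopy⟩)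

theorem foldr_max_lt_iff {L : Type v} [LinearOrder L] {z x : L} {l : List L} :
    l.foldr max z < x ↔ z < x ∧ ∀ y ∈ l, y < x := by
  induction l with
  | nil => simp
  | cons y l ih => simp [ih, and_left_comm]

/-- Such lists have all entries below a fixed `y > x`, and there are fewer than the cofinality many
finite lists over that initial segment. -/
theorem mk_list_foldr_max_eq_lt (hreg : κ.IsRegular) (hω : ℵ₀ < Order.cof (Below κ))
    (z x : Below κ) : #{l : List (Below κ) // l.foldr max z = x} < Order.cof (Below κ) := by
  have := noMaxOrder_below hreg
  obtain ⟨y, hy⟩ := exists_gt x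
  have hsub : {l : List (Below κ) | l.foldr max z = x} ⊆
      Set.range (List.map ((↑) : Set.Iio y → Below κ)) := by
    rintro l rfl
    rw [Set.range_list_map_coe]
    exact (foldr_max_lt_iff.1 hy).2
  refine ((mk_le_mk_of_subset hsub).trans mk_range_le).trans_lt ?_
  exact (mk_list_le_max _).trans_lt (max_lt hω (mk_Iio_lt_cof_below hreg y))

theorem codeHom_surjective (hreg : κ.IsRegular) (hω : ℵ₀ < Order.cof (Below κ))
    (hC : IsClubGuessing S C) (ha : Enumerates S C a) :
    Function.Surjective (codeHom hreg hω ha) := by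
  intro F
  induction F using Filter.Germ.inductionOn with
  | h s =>
  have := noMaxOrder_below hreg
  have hne := nonempty_below hreg
  have hsmall := mk_Iio_lt_cof_below hreg
  have haleph : ℵ₀ ≤ #(Below κ) := by simpa [mk_below] using hreg.aleph0_le
  have : Infinite (Below κ) := infinite_iff.2 haleph
  let ι := Σ δ : S, (s δ).1
  let X : ι → Set ℕ := fun i => Quotient.out i.2.1
  have hX : ∀ i, (⟦X i⟧ : PowModFin) = i.2.1 := fun i => Quotient.out_eq _
  let b : ι → ℕ → Below κ := fun i n => a i.1 (Nat.nth (· ∈ padOdd (X i)) n)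
  have hb : ∀ i, IsLUB (Set.range (b i)) i.1.1 := by
    intro i
    have hlub := hC.isLUB i.1 i.1.2
    rw [← ha.range_eq i.1 i.1.2] at hlub
    refine ⟨?_, fun y hy => hlub.2 ?_⟩
    · rintro _ ⟨n, rfl⟩
      exact hlub.1 ⟨_, rfl⟩
    · rintro _ ⟨n, rfl⟩
      -- The `n`-th element of an infinite set is at least `n`, so the branch is cofinal in the
      -- ladder.
      exact (ha.monotone _ (Nat.nth_strictMono (padOdd_infinite (X i))).le_apply).trans
        (hy ⟨n, rfl⟩)
  have hcard : #(List (Below κ) ⊕ ι) = Cardinal.lift.{u + 1} κ := by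
    have hι : #ι ≤ #(Below κ) := by
      have hex : ∀ δ, Nonempty ((s δ).1 ↪ Below κ) := fun δ =>
        Cardinal.lift_mk_le'.1 (by
          have := Cardinal.lift_le.{u + 1}.2 (s δ).2
          simpa [mk_below] using this)
      let f := fun δ => (hex δ).some
      have hinj : Function.Injective fun i : ι => (i.1.1, f i.1 i.2) := by
        rintro ⟨δ, x⟩ ⟨ε, y⟩ h
        obtain rfl : δ = ε := Subtype.ext (congrArg Prod.fst h)
        exact congrArg _ ((f δ).injective (congrArg Prod.snd h))
      refine (mk_le_of_injective hinj).trans ?_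
      rw [mk_prod, Cardinal.lift_id, mul_eq_self haleph]
    rw [mk_sum, Cardinal.lift_id, Cardinal.lift_id, mk_list_eq_mk,
      add_eq_left haleph hι, mk_below]
  obtain ⟨G, ⟨e⟩⟩ := exists_classGraph (κ := κ) (inClass_branchGraph b) (by
    rw [hcard]
    simp)
  refine ⟨⟦G⟧, (codeHom_mk hreg hω ha G).trans (Filter.Germ.coe_eq.2 ?_)⟩
  obtain ⟨z⟩ := hne
  let p : List (Below κ) → Below κ := fun l => l.foldr max z
  let q : List (Below κ) → Below κ := fun l => G.label (e (.inl l))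
  -- On this club the label of a node and the maximum of its entries fall below the same points; the
  -- factor `Ioi z` handles `z`, the default maximum of the empty list.
  refine eventually_of_isClub ha hω
    (((isClub_closed hω hsmall (p := p) (q := q)
      (by simpa using mk_list_foldr_max_eq_lt hreg hω z)).inter hω.ne'
    (isClub_closed hω hsmall (p := q) (q := p)
      (mk_fiber_lt_of_injective hω
        (G.label.injective.comp (e.injective.comp Sum.inl_injective))))).inter hω.ne'
    (isClub_Ioi z)) ?_
  intro δ hδ N hN
  have hstrict := ha.strictMono δ hδ
  have hlub := hC.isLUB δ hδ
  rw [← ha.range_eq δ hδ] at hlub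
  have hq : ∀ n, N ≤ n → ∀ l, q l < a δ n ↔ ∀ x ∈ l, x < a δ n := fun n hn l =>
    ⟨fun h => (foldr_max_lt_iff.1 ((hN n hn).1.2 l h)).2,
      fun h => (hN n hn).1.1 l (foldr_max_lt_iff.2 ⟨(hN n hn).2, h⟩)⟩
  refine Subtype.ext (?_ : codes G.graph G.label (a δ) = (s δ).1)
  have heq : codes G.graph G.label (a δ) =
      codes (branchGraph b) (fun y => G.label (e y)) (a δ) :=
    (codes_subset_of_copy (N := 0) e.symm.toCopy fun n _ x => by
      change _ ↔ G.label (e (e.symm x)) < _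
      rw [e.apply_symm_apply]).antisymm
    (codes_subset_of_copy (N := 0) e.toCopy fun n _ x => Iff.rfl)
  rw [heq]
  ext y
  rw [mem_codes_branchGraph hstrict.monotone]
  constructor
  · rintro ⟨i, Y, rfl, hY⟩
    -- A branch built for `δ` codes its own element; any other leaves a finite trace, which no
    -- `padOdd Y` matches.
    by_cases hi : i.1.1 = δ
    · obtain ⟨⟨_, hδ'⟩, x⟩ := i
      obtain rfl := hi
      have h := trace_initialList_modFin hq hstrict (padOdd_infinite (X ⟨⟨_, hδ'⟩, x⟩))
      have := Quotient.sound (padOdd_modFin_padOdd (Setoid.trans (Setoid.symm h) hY))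
      rw [← this, hX]
      exact x.2
    · exact (not_padOdd_modFin_empty Y (Setoid.trans (Setoid.symm hY)
        (trace_initialList_modFin_empty hq hstrict hlub (hb i) hi))).elim
  · intro hy
    exact ⟨⟨⟨δ, hδ⟩, ⟨y, hy⟩⟩, X ⟨⟨δ, hδ⟩, ⟨y, hy⟩⟩, (hX ⟨⟨δ, hδ⟩, ⟨y, hy⟩⟩).symm,
      trace_initialList_modFin hq hstrict (padOdd_infinite _)⟩

end CodeHom
end RayGraphs

theorem theorem1p10 (κ : Cardinal.{u}) (hreg : κ.IsRegular) (hκ : ℵ₁ < κ) :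
    ∃ (S : Set (RayGraphs.Below κ)) (C : RayGraphs.Below κ → Set (RayGraphs.Below κ))
      (I : Order.Ideal (Set (RayGraphs.Below κ)))
      (Φ : RayGraphs.IsoTypes κ →o RayGraphs.SmallSubsets ℝ κ),
      RayGraphs.IsClubGuessing S C ∧
      (∀ X : Set (RayGraphs.Below κ), X ∈ I ↔ RayGraphs.GuessingNull S C X) ∧
      RayGraphs.IsNormalIdeal I ∧
      Function.Surjective Φ ∧
      (∃ (φ : RayGraphs.IsoTypes κ →o RayGraphs.ReducedPower ℝ I)
        (ψ : RayGraphs.ReducedPower ℝ I →o RayGraphs.SmallSubsets ℝ κ),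
        Function.Surjective φ ∧ Function.Surjective ψ ∧ Φ = ψ.comp φ ∧
        ∀ s : RayGraphs.Below κ → RayGraphs.SmallSubsets ℝ κ,
          (ψ (s : RayGraphs.ReducedPower ℝ I) : Set ℝ) = RayGraphs.positivePart I s) ∧
      (∃ (e : RayGraphs.PowModFin ≃ ℝ)
        (φ : RayGraphs.IsoTypes κ →o RayGraphs.ReducedPower RayGraphs.PowModFin I)
        (ψ : RayGraphs.ReducedPower RayGraphs.PowModFin I →o RayGraphs.SmallSubsets ℝ κ),
        Function.Surjective φ ∧ Function.Surjective ψ ∧ Φ = ψ.comp φ ∧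
        ∀ s : RayGraphs.Below κ → RayGraphs.SmallSubsets RayGraphs.PowModFin κ,
          (ψ (s : RayGraphs.ReducedPower RayGraphs.PowModFin I) : Set ℝ) =
            e '' RayGraphs.positivePart I s) := by
  obtain ⟨S, C, hC⟩ := RayGraphs.exists_isClubGuessing hreg hκ
  obtain ⟨a, ha⟩ := hC.exists_enumerates
  obtain ⟨e⟩ := RayGraphs.nonempty_powModFin_equiv_real
  have hω : ℵ₀ < Order.cof (RayGraphs.Below κ) := by
    rw [RayGraphs.cof_below hreg, ← lift_aleph0.{u + 1, u}, Cardinal.lift_lt]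
    exact aleph0_lt_aleph_one.trans hκ
  have hI := RayGraphs.isNormalIdeal_guessingIdeal hreg hω hC
  have hκ0 := hreg.aleph0_le
  have hφ := RayGraphs.codeHom_surjective hreg hω hC ha
  have hφR := (RayGraphs.reducedPowerHom_surjective
    (I := RayGraphs.guessingIdeal hω S C) e).comp hφ
  have hψ : ∀ A : Type, Function.Surjective (RayGraphs.positivePartHom hκ0 :
      RayGraphs.ReducedPower A (RayGraphs.guessingIdeal hω S C) →o _) := fun A =>
    RayGraphs.positivePartHom_surjective hκ0 hI.proper
  refine ⟨S, C, RayGraphs.guessingIdeal hω S C,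
    (RayGraphs.positivePartHom hκ0).comp
      ((RayGraphs.reducedPowerHom _ e).comp (RayGraphs.codeHom hreg hω ha)),
    hC, fun X => Iff.rfl, hI, (hψ ℝ).comp hφR,
    ⟨_, _, hφR, hψ ℝ, rfl, fun s => rfl⟩,
    e, RayGraphs.codeHom hreg hω ha,
    (RayGraphs.smallSubsetsIso e κ).toOrderEmbedding.toOrderHom.comp (RayGraphs.positivePartHom hκ0),
    hφ, (RayGraphs.smallSubsetsIso e κ).surjective.comp (hψ _), ?_, fun s => rfl⟩
  ext1
  funext t
  exact RayGraphs.positivePartHom_reducedPowerHom hκ0 e (RayGraphs.codeHom hreg hω ha t)
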